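/- For a connected graph $G$, the conflict-free connection number $\mathrm{cfc}(G)$ is the smallest number $k$ of colors for which the edges of $G$ can be colored with $k$ colors so that any two distinct vertices are joined by a path containing a color that is used on exactly one edge of the path; for a disconnected graph we put $\mathrm{cfc}(G)=\infty$. Let $G(n,p)$ be the Erdős–Rényi random graph on $n$ labeled vertices, in which each of the $\binom n2$ pairs is an edge independently with probability $p$. **Theorem.** Let $p=p(n)\in[0,1]$ and let $\alpha(n)\to\infty$ as $n\to\infty$. 1. If $p(n)\ge\frac{\log n+\alpha(n)}{n}$ for all sufficiently large $n$, then $$\Pr[\mathrm{cfc}(G(n,p))\le 2]\to 1\quad\text{and}\quad \Pr[G(n,p)\text{ is connected}]\to 1 .$$ If moreover $p(n)^{\binom n2}\to 0$ (that is, with high probability $G(n,p)$ is not complete), then $\Pr[\mathrm{cfc}(G(n,p))=2]\to 1$. 2. If $p(n)\le\frac{\log n-\alpha(n)}{n}$ for all sufficiently large $n$, then $$\Pr[\mathrm{cfc}(G(n,p))\le 2]\to 0\quad\text{and}\quad \Pr[G(n,p)\text{ is connected}]\to 0 .$$ Thus $\mathrm{cfc}(G(n,p))\le 2$ and connectivity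 have the same threshold, in the sense of 1 and 2, and so has $\mathrm{cfc}(G(n,p))=2$ as long as $G(n,p)$ is with high probability not complete. -/

import Mathlib

open Filter Topology

namespace SimpleGraph

/-- An edge-colouring is a conflict-free connection colouring if any two distinct vertices are
joined by a path containing a colour that is used on exactly one of the edges of the path. -/
def EdgeLabeling.IsConflictFreeConnected {V K : Type*} {G : SimpleGraph V}
    (C : G.EdgeLabeling K) : Prop :=
  ∀ u v : V, u ≠ v → ∃ w : G.Walk u v, w.IsPath ∧
    ∃ c : K, ∃! e : G.edgeSet, (e : Sym2 V) ∈ w.edges ∧ C e = c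

/-- The conflict-free connection number `cfc(G)`: the least number of colours in a conflict-free
connection colouring of `G`. It is `⊤` if there is none, in particular if `G` has two vertices
that are not joined by a path. -/
noncomputable def conflictFreeConnectionNumber {V : Type*} (G : SimpleGraph V) : ℕ∞ :=
  ⨅ (k : ℕ) (_ : ∃ C : G.EdgeLabeling (Fin k), C.IsConflictFreeConnected), (k : ℕ∞)

end SimpleGraph

/-! Give one edge `xy` colour 0 and every other edge colour 1. Each path through `xy` is then
conflict-free, and so is each single edge. Let `H` be the set of vertices with at least two
neighbours. Suppose that in a connected graph no vertex cuts off a set `U` with 2 ≤ |U| ≤ n - 3.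
Then the leaves hang from distinct vertices of `H`, and no vertex of `H` separates two others. As in
a 2-connected graph, any two vertices of `H` are joined by a path through `xy`
(`exists_isPath_mem_edges_of_core`), and leaves only prolong such paths. So cfc ≤ 2
(`conflictFreeConnectionNumber_le_two_of_expanding`).

Above the threshold, a union bound over cuts gives connectivity. For a vertex `z` cutting off `U`,
the plain union bound is useless: near p = log n / n a fixed size |U| already contributes order n.
But connectivity forces two edges inside `U ∪ {z}`, and their extra factor p² brings the total down
to O(log² n / n).

Below the threshold, the second moment method yields an isolated vertex, which rules out
connectivity and hence cfc ≤ 2. Finally, cfc < 2 forces the graph to be complete. -/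

namespace SimpleGraph

/-! ### Paths through a prescribed edge and the two-colouring -/

variable {V : Type*} {G : SimpleGraph V}

lemma Walk.IsPath.append_of_inter {u v w : V} {p : G.Walk u v} {q : G.Walk v w} (hp : p.IsPath)
    (hq : q.IsPath) (h : ∀ x ∈ p.support, x ∈ q.support → x = v) : (p.append q).IsPath := by
  rw [Walk.isPath_def, Walk.support_append]
  have hq' := hq.support_nodup
  rw [← Walk.cons_tail_support] at hq'
  refine List.Nodup.append hp.support_nodup (List.nodup_cons.1 hq').2 fun x hx hx' => ?_
  obtain rfl := h x hx (List.mem_of_mem_tail hx')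
  exact (List.nodup_cons.1 hq').1 hx'

/-- Moving the first endpoint of a path through a given edge to a neighbouring vertex. -/
lemma exists_isPath_mem_edges_of_adj {a b v : V} {e : Sym2 V} {P : G.Walk a v} (hP : P.IsPath)
    (he : e ∈ P.edges) (hab : G.Adj b a) (Z : G.Walk v a) (hZ : b ∉ Z.support) :
    ∃ Q : G.Walk b v, Q.IsPath ∧ e ∈ Q.edges := by
  classical
  by_cases hb : b ∈ P.support
  swap
  · exact ⟨P.cons hab, hP.cons hb, by simp [he]⟩
  obtain ⟨C, T, hC, hT, rfl⟩ := hP.mem_support_iff_exists_append.1 hb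
  rw [Walk.edges_append, List.mem_append] at he
  obtain he | he := he
  swap
  · exact ⟨T, hT, he⟩
  -- Here `e` lies on `C`, which the edge `ba` closes up. Let `w` be the first vertex of `Z`, coming
  -- from `v`, that lies on `C`. Since `w ≠ b`, one of the two ways round from `b` to `w` contains
  -- `e`, and `Y` continues it to `v`.
  obtain ⟨w, hwC, hwZ, hw⟩ := Z.exists_mem_support_forall_mem_support_imp_eq C.support.toFinset
    ⟨a, by simp⟩
  rw [List.mem_toFinset] at hwC
  set Y := (Z.takeUntil w hwZ).bypass.reverse with hY
  have hYp : Y.IsPath := (Walk.bypass_isPath _).reverse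
  have hYs : ∀ x ∈ Y.support, x ∈ (Z.takeUntil w hwZ).support := fun x hx => by
    rw [hY, Walk.support_reverse, List.mem_reverse] at hx
    exact Walk.support_bypass_subset_support _ hx
  have hYb : b ∉ Y.support := fun h =>
    hZ (Walk.support_takeUntil_subset_support _ _ (hYs _ h))
  have hYC : ∀ x ∈ C.support, x ∈ Y.support → x = w := fun x hx hx' =>
    hw x (by simpa using hx) (hYs x hx')
  have hwb : b ≠ w := fun h => hZ (h ▸ hwZ)
  obtain ⟨C₁, C₂, hC₁, hC₂, rfl⟩ := hC.mem_support_iff_exists_append.1 hwC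
  rw [Walk.edges_append, List.mem_append] at he
  obtain he | he := he
  · refine ⟨(C₁.append Y).cons hab, Walk.IsPath.cons (hC₁.append_of_inter hYp fun x hx hx' =>
      hYC x (by simp [hx]) hx') ?_, by simp [he]⟩
    rw [Walk.mem_support_append_iff]
    rintro (h | h)
    · exact hC.ne_of_mem_support_of_append hwb h (Walk.end_mem_support _) rfl
    · exact hYb h
  · refine ⟨C₂.reverse.append Y, hC₂.reverse.append_of_inter hYp fun x hx hx' =>
      hYC x ?_ hx', by simp [he]⟩
    rw [Walk.support_reverse, List.mem_reverse] at hx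
    simp [hx]

/-- The endpoint moves along `W` one edge at a time. The return walk needed for each move comes from
`hH`, with the new endpoint as the avoided vertex; this is why `W` must miss `v`. -/
lemma exists_isPath_mem_edges_of_walk {H : Set V} {v : V} {e : Sym2 V} (hv : v ∈ H)
    (hH : ∀ z ∈ H, ∀ a ∈ H, ∀ b ∈ H, a ≠ z → b ≠ z → ∃ W : G.Walk a b, z ∉ W.support)
    {x u : V} (W : G.Walk x u) (hW : ∀ y ∈ W.support, y ∈ H ∧ y ≠ v)
    (hx : ∃ P : G.Walk x v, P.IsPath ∧ e ∈ P.edges) :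
    ∃ P : G.Walk u v, P.IsPath ∧ e ∈ P.edges := by
  induction W with
  | nil => exact hx
  | @cons a b c hab q ih =>
    refine ih (fun y hy => hW y (by simp [hy])) ?_
    obtain ⟨P, hP, he⟩ := hx
    have ha := hW a (by simp)
    have hb := hW b (by simp)
    obtain ⟨Z, hZ⟩ := hH b hb.1 v hv a ha.1 hb.2.symm hab.ne
    exact exists_isPath_mem_edges_of_adj hP he hab.symm Z hZ

/-- If no vertex separates two vertices of the set `H` and all vertices outside `H` are leaves,
then any two vertices of `H` are joined by a path through any given edge inside `H`. -/
theorem exists_isPath_mem_edges_of_core {H : Set V}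
    (hleaf : ∀ v ∉ H, (G.neighborSet v).Subsingleton)
    (hH : ∀ z ∈ H, ∀ a ∈ H, ∀ b ∈ H, a ≠ z → b ≠ z → ∃ W : G.Walk a b, z ∉ W.support)
    {x y : V} (hx : x ∈ H) (hy : y ∈ H) (hxy : G.Adj x y) {u v : V} (hu : u ∈ H) (hv : v ∈ H)
    (huv : u ≠ v) : ∃ P : G.Walk u v, P.IsPath ∧ s(x, y) ∈ P.edges := by
  classical
  wlog hvx : v ≠ x generalizing x y
  · obtain rfl := not_ne_iff.1 hvx
    rw [Sym2.eq_swap]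
    exact this hy hx hxy.symm hxy.ne
  obtain ⟨Y, hY⟩ := hH x hx y hy v hv hxy.ne.symm hvx
  obtain ⟨W, hW⟩ := hH v hv x hx u hu hvx.symm huv
  -- The initial path is `x`, `y` and then `Y` to `v`, off `x`. Shortening `W` to a path keeps it in
  -- `H`, because a leaf is never interior to a path.
  refine exists_isPath_mem_edges_of_walk hv hH W.bypass (fun t ht => ⟨?_, ?_⟩)
    ⟨Y.bypass.cons hxy, (Walk.bypass_isPath _).cons fun h =>
      hY (Walk.support_bypass_subset_support _ h), by simp⟩
  · by_contra htH
    exact (Walk.bypass_isPath W).isTrail.not_mem_support_of_subsingleton_neighborSet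
      (by rintro rfl; exact htH hx) (by rintro rfl; exact htH hu) (hleaf t htH) ht
  · rintro rfl
    exact hW (Walk.support_bypass_subset_support _ ht)

lemma conflictFreeConnectionNumber_le_two_of_edge {e : Sym2 V} (heG : e ∈ G.edgeSet)
    (h : ∀ u v, u ≠ v → G.Adj u v ∨ ∃ P : G.Walk u v, P.IsPath ∧ e ∈ P.edges) :
    G.conflictFreeConnectionNumber ≤ 2 := by
  classical
  refine iInf₂_le_of_le 2 ⟨fun f => if (f : Sym2 V) = e then 0 else 1, fun u v huv => ?_⟩ le_rfl
  obtain huv | ⟨P, hP, he⟩ := h u v huv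
  · refine ⟨huv.toWalk, huv.isPath_toWalk, _, ⟨⟨s(u, v), huv⟩, ⟨by simp, rfl⟩, ?_⟩⟩
    rintro ⟨f, hf⟩ ⟨hf', -⟩
    exact Subtype.ext (by simpa using hf')
  · refine ⟨P, hP, 0, ⟨⟨e, heG⟩, ⟨he, by simp⟩, ?_⟩⟩
    rintro ⟨f, hf⟩ ⟨-, hf'⟩
    simpa using hf'

lemma conflictFreeConnectionNumber_lt_iff {k : ℕ∞} : G.conflictFreeConnectionNumber < k ↔
    ∃ m : ℕ, (m : ℕ∞) < k ∧ ∃ C : G.EdgeLabeling (Fin m), C.IsConflictFreeConnected := by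
  simp only [conflictFreeConnectionNumber, iInf_lt_iff, exists_prop]
  exact exists_congr fun _ => and_comm

lemma preconnected_of_conflictFreeConnectionNumber_le_two
    (h : G.conflictFreeConnectionNumber ≤ 2) : G.Preconnected := by
  -- Passing from `≤ 2` to `< 3` lets the infimum yield an actual colouring.
  obtain ⟨m, -, C, hC⟩ := conflictFreeConnectionNumber_lt_iff.1
    (lt_of_le_of_lt h (by decide : (2 : ℕ∞) < 3))
  intro u v
  by_cases huv : u = v
  · exact huv ▸ Reachable.refl _
  · exact (hC u v huv).choose.reachable

/-- With at most one colour available, a colour occurring exactly once on a path forces the path to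
be a single edge. -/
lemma eq_top_of_conflictFreeConnectionNumber_lt_two
    (h : G.conflictFreeConnectionNumber < 2) : G = ⊤ := by
  obtain ⟨m, hm, C, hC⟩ := conflictFreeConnectionNumber_lt_iff.1 h
  have hm : m ≤ 1 := by
    have : m < 2 := by exact_mod_cast hm
    omega
  have hsub : Subsingleton (Fin m) := Fin.subsingleton_iff_le_one.2 hm
  rw [eq_top_iff]
  intro u v huv
  obtain ⟨w, hw, c, e, -, he⟩ := hC u v huv
  match w, hw with
  | .nil, _ => exact absurd rfl huv
  | .cons h .nil, _ => exact h
  | .cons h (.cons h' q), hw =>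
    have h₁ := he ⟨s(_, _), h⟩ ⟨by simp, Subsingleton.elim _ _⟩
    have h₂ := he ⟨s(_, _), h'⟩ ⟨by simp, Subsingleton.elim _ _⟩
    have h₃ := congrArg Subtype.val (h₁.trans h₂.symm)
    have := hw.isTrail.edges_nodup
    simp only [Walk.edges_cons, List.nodup_cons, List.mem_cons] at this
    exact absurd (Or.inl h₃) this.1

section Fintype

variable [Fintype V] [DecidableEq V]

/-- Otherwise the set reached from `a` off `z` has no edge leaving it except to `z`. It contains `a`
and a neighbour of `a`, and misses `z`, `b` and a neighbour of `b`, so its size is in the forbidden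
range. -/
lemma exists_walk_notMem_support_of_expanding
    (hU : ∀ z, ∀ U : Finset V, z ∉ U → 2 ≤ U.card → U.card + 3 ≤ Fintype.card V →
      ∃ a ∈ U, ∃ b ∉ U, b ≠ z ∧ G.Adj a b) {z a b : V}
    (ha : ¬ (G.neighborSet a).Subsingleton) (hb : ¬ (G.neighborSet b).Subsingleton)
    (haz : a ≠ z) (hbz : b ≠ z) : ∃ W : G.Walk a b, z ∉ W.support := by
  classical
  have hnbr : ∀ c : V, ¬ (G.neighborSet c).Subsingleton → ∃ d, G.Adj c d ∧ d ≠ z := by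
    intro c hc
    by_contra! hcon
    exact hc fun s hs t ht => (hcon s hs).trans (hcon t ht).symm
  by_contra hab
  let U : Finset V := {x | ∃ W : G.Walk a x, z ∉ W.support}
  have hmem : ∀ x, x ∈ U ↔ ∃ W : G.Walk a x, z ∉ W.support := fun x => by simp [U]
  have hclosed : ∀ x ∈ U, ∀ y, G.Adj x y → y ≠ z → y ∈ U := by
    intro x hx y hxy hyz
    obtain ⟨W, hW⟩ := (hmem x).1 hx
    refine (hmem y).2 ⟨W.concat hxy, ?_⟩
    simp [Walk.support_concat, hW, hyz.symm]
  have hzU : z ∉ U := fun h => by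
    obtain ⟨W, hW⟩ := (hmem z).1 h
    exact hW W.end_mem_support
  have haU : a ∈ U := (hmem a).2 ⟨.nil, by simpa using haz.symm⟩
  obtain ⟨c, hac, hcz⟩ := hnbr a ha
  obtain ⟨d, hbd, hdz⟩ := hnbr b hb
  have hbU : b ∉ U := fun h => hab ((hmem b).1 h)
  have hdU : d ∉ U := fun h => hbU (hclosed d h b hbd.symm hbz)
  have h2 : 2 ≤ U.card := by
    rw [← Finset.card_pair hac.ne]
    exact Finset.card_le_card (by simp [Finset.insert_subset_iff, haU, hclosed a haU c hac hcz])
  have h3 : U.card + 3 ≤ Fintype.card V := by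
    have : ({z, b, d} : Finset V).card = 3 := by
      rw [Finset.card_eq_three]
      exact ⟨z, b, d, hbz.symm, hdz.symm, hbd.ne, rfl⟩
    rw [← this, ← Finset.card_union_of_disjoint]
    · exact Finset.card_le_univ _
    · simp [hzU, hbU, hdU]
  obtain ⟨s, hs, t, ht, htz, hst⟩ := hU z U hzU h2 h3
  exact ht (hclosed s hs t hst htz)

/-- A connected graph has conflict-free connection number at most two if no vertex separates
more than one vertex from the rest. -/
theorem conflictFreeConnectionNumber_le_two_of_expanding (hG : G.Connected)
    (hcard : 5 ≤ Fintype.card V)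
    (hU : ∀ z, ∀ U : Finset V, z ∉ U → 2 ≤ U.card → U.card + 3 ≤ Fintype.card V →
      ∃ a ∈ U, ∃ b ∉ U, b ≠ z ∧ G.Adj a b) :
    G.conflictFreeConnectionNumber ≤ 2 := by
  let H : Set V := {v | ¬ (G.neighborSet v).Subsingleton}
  have hleaf : ∀ v ∉ H, (G.neighborSet v).Subsingleton := fun v hv => not_not.1 hv
  have hH : ∀ z ∈ H, ∀ a ∈ H, ∀ b ∈ H, a ≠ z → b ≠ z → ∃ W : G.Walk a b, z ∉ W.support :=
    fun z _ a ha b hb => exists_walk_notMem_support_of_expanding hU ha hb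
  have : Nontrivial V := Fintype.one_lt_card_iff_nontrivial.1 (by omega)
  -- Two-element sets fall under `hU` exactly because there are at least 2 + 3 vertices.
  have hpair : ∀ z s t, s ≠ t → s ≠ z → t ≠ z → ∃ a ∈ ({s, t} : Finset V), ∃ b,
      b ≠ s ∧ b ≠ t ∧ b ≠ z ∧ G.Adj a b := by
    intro z s t hst hsz htz
    obtain ⟨a, ha, b, hb, hbz, hab⟩ := hU z {s, t} (by simp [hsz.symm, htz.symm])
      (Finset.card_pair hst).ge (by rw [Finset.card_pair hst]; omega)
    simp only [Finset.mem_insert, Finset.mem_singleton, not_or] at hb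
    exact ⟨a, ha, b, hb.1, hb.2, hbz, hab⟩
  have hnbr : ∀ l ∉ H, ∃ m ∈ H, G.Adj l m := by
    intro l hl
    obtain ⟨m, hm⟩ := hG.preconnected.exists_adj_of_nontrivial l
    refine ⟨m, fun hmH => ?_, hm⟩
    obtain ⟨z, hz⟩ : ∃ z, z ∉ ({l, m} : Finset V) := by
      by_contra! hcon
      have := Finset.card_le_card (fun x _ => hcon x : Finset.univ ⊆ ({l, m} : Finset V))
      rw [Finset.card_pair hm.ne, Finset.card_univ] at this
      omega
    simp only [Finset.mem_insert, Finset.mem_singleton, not_or] at hz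
    obtain ⟨a, ha, b, hbl, hbm, -, hab⟩ := hpair z l m hm.ne (Ne.symm hz.1) (Ne.symm hz.2)
    simp only [Finset.mem_insert, Finset.mem_singleton] at ha
    obtain rfl | rfl := ha
    · exact hbm (hleaf _ hl hab hm)
    · exact hbl (hmH hab hm.symm)
  have hcommon : ∀ l ∉ H, ∀ l' ∉ H, ∀ z, G.Adj z l → G.Adj z l' → l = l' := by
    intro l hl l' hl' z hz hz'
    by_contra hne
    obtain ⟨a, ha, b, -, -, hbz, hab⟩ := hpair z l l' hne hz.ne.symm hz'.ne.symm
    simp only [Finset.mem_insert, Finset.mem_singleton] at ha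
    obtain rfl | rfl := ha
    · exact hbz (hleaf _ hl hab hz.symm)
    · exact hbz (hleaf _ hl' hab hz'.symm)
  obtain ⟨x, hx⟩ : ∃ x, x ∈ H := by
    obtain ⟨v⟩ := hG.nonempty
    by_cases hv : v ∈ H
    · exact ⟨v, hv⟩
    · exact (hnbr v hv).imp fun _ h => h.1
  -- If all neighbours of `x` were leaves, `hcommon` would identify them, making `x` a leaf.
  obtain ⟨y, hy, hxy⟩ : ∃ y ∈ H, G.Adj x y := by
    by_contra! hcon
    exact hx fun c hc d hd => hcommon c (fun h => hcon c h hc) d (fun h => hcon d h hd) x hc hd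
  have hcore : ∀ u v, u ∈ H → v ∈ H → u ≠ v → ∃ P : G.Walk u v, P.IsPath ∧ s(x, y) ∈ P.edges :=
    fun u v hu hv => exists_isPath_mem_edges_of_core hleaf hH hx hy hxy hu hv
  -- The adjacency alternative retains `u ∉ H`: for two leaves, applied to `u` and the neighbour of
  -- the other leaf, it contradicts `hcommon`.
  have hhalf : ∀ u v, v ∈ H → u ≠ v → (u ∉ H ∧ G.Adj u v) ∨
      ∃ P : G.Walk u v, P.IsPath ∧ s(x, y) ∈ P.edges := by
    intro u v hv huv
    by_cases hu : u ∈ H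
    · exact Or.inr (hcore u v hu hv huv)
    obtain ⟨m, hm, hum⟩ := hnbr u hu
    by_cases hmv : m = v
    · exact Or.inl ⟨hu, hmv ▸ hum⟩
    obtain ⟨P, hP, he⟩ := hcore m v hm hv hmv
    exact Or.inr ⟨P.cons hum, hP.cons (hP.isTrail.not_mem_support_of_subsingleton_neighborSet
      hum.ne huv (hleaf u hu)), by simp [he]⟩
  refine conflictFreeConnectionNumber_le_two_of_edge (e := s(x, y)) hxy fun u v huv => ?_
  by_cases hv : v ∈ H
  · exact (hhalf u v hv huv).imp And.right id
  obtain ⟨m, hm, hvm⟩ := hnbr v hv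
  by_cases hum : u = m
  · exact Or.inl (hum ▸ hvm.symm)
  obtain ⟨hu, hadj⟩ | ⟨P, hP, he⟩ := hhalf u m hm hum
  · exact absurd (hcommon u hu v hv m hadj.symm hvm.symm) huv
  · exact Or.inr ⟨P.concat hvm.symm, hP.concat
      (hP.isTrail.not_mem_support_of_subsingleton_neighborSet huv.symm hvm.ne (hleaf v hv)) _,
      by simp [Walk.edges_concat, he]⟩

end Fintype

end SimpleGraph

/-! ### First-moment bounds for cuts and separating vertices -/

namespace SimpleGraph

open MeasureTheory ProbabilityTheory unitInterval

variable {V : Type*}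

instance [Finite V] : MeasurableSingletonClass (SimpleGraph V) where
  measurableSet_singleton G := by
    have : ({G} : Set (SimpleGraph V)) = edgeSet ⁻¹' {G.edgeSet} := by ext; simp
    rw [this]
    exact measurable_edgeSet (measurableSet_singleton _)

section Cylinder

variable [Finite V] [DecidableEq V]

/-- The edges in `A` are present and those in `B` are absent with probability
`p ^ |A| * (1 - p) ^ |B|`. -/
theorem binomialRandom_real_cylinder (p : I) {A B : Finset (Sym2 V)} (hAB : Disjoint A B)
    (hA : ∀ e ∈ A, ¬ e.IsDiag) (hB : ∀ e ∈ B, ¬ e.IsDiag) :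
    (binomialRandom V p).real {G | (∀ e ∈ A, e ∈ G.edgeSet) ∧ ∀ e ∈ B, e ∉ G.edgeSet} =
      (p : ℝ) ^ A.card * (1 - p : ℝ) ^ B.card := by
  let t : Sym2 V → Set Prop := fun e => if e ∈ A then {True} else {False}
  -- In the product space of independent coordinates the event is a box. Diagonal pairs must be
  -- excluded since `fromEdgeSet` discards them.
  have hpre : (fun f : Sym2 V → Prop => {i | f i}) ⁻¹' (fromEdgeSet ⁻¹'
      {G : SimpleGraph V | (∀ e ∈ A, e ∈ G.edgeSet) ∧ ∀ e ∈ B, e ∉ G.edgeSet}) =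
      Set.pi ((A ∪ B : Finset (Sym2 V)) : Set (Sym2 V)) t := by
    ext f
    simp only [Set.mem_preimage, Set.mem_ofPred_eq, edgeSet_fromEdgeSet, Set.mem_sdiff,
      Set.mem_pi, Finset.coe_union, Set.mem_union, Finset.mem_coe, t]
    constructor
    · rintro ⟨h₁, h₂⟩ e (he | he)
      · simpa [he] using (h₁ e he).1
      · have heA : e ∉ A := fun h => Finset.disjoint_left.1 hAB h he
        simpa [heA] using fun h => h₂ e he ⟨h, hB e he⟩
    · intro h
      refine ⟨fun e he => ⟨?_, hA e he⟩, fun e he hf => ?_⟩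
      · simpa [he] using h e (Or.inl he)
      · have heA : e ∉ A := fun h => Finset.disjoint_left.1 hAB h he
        have := h e (Or.inr he)
        simp only [heA, if_false, Set.mem_singleton_iff, eq_iff_iff, iff_false] at this
        exact this hf.1
  rw [measureReal_def, binomialRandom_eq_map, Measure.map_apply measurable_fromEdgeSet
    (Set.toFinite _).measurableSet, setBernoulli_eq_map, Measure.map_apply (by fun_prop)
    (measurable_fromEdgeSet (Set.toFinite _).measurableSet), hpre,
    Measure.infinitePi_pi _ (fun _ _ => by measurability), Finset.prod_union hAB,
    ENNReal.toReal_mul]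
  congr 1
  · rw [Finset.prod_congr rfl (g := fun _ => (toNNReal p : ENNReal)), Finset.prod_const]
    · simp
    · intro e he
      simp [t, he, hA e he]
  · rw [Finset.prod_congr rfl (g := fun _ => (toNNReal (σ p) : ENNReal)), Finset.prod_const]
    · simp
    · intro e he
      have heA : e ∉ A := fun h => Finset.disjoint_left.1 hAB h he
      simp [t, heA, hB e he]

end Cylinder

/-- The pairs with one element in `S` and one in `T`. -/
def pairsBetween [DecidableEq V] (S T : Finset V) : Finset (Sym2 V) :=
  (S ×ˢ T).image fun x => s(x.1, x.2)

section Pairs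

variable [DecidableEq V] {S T : Finset V}

lemma mem_pairsBetween {e : Sym2 V} : e ∈ pairsBetween S T ↔ ∃ a ∈ S, ∃ b ∈ T, s(a, b) = e := by
  simp [pairsBetween, and_assoc]

lemma card_pairsBetween (h : Disjoint S T) : (pairsBetween S T).card = S.card * T.card := by
  rw [pairsBetween, Finset.card_image_of_injOn, Finset.card_product]
  rintro ⟨a, b⟩ hab ⟨c, d⟩ hcd heq
  simp only [Finset.coe_product, Set.mem_prod, Finset.mem_coe] at hab hcd
  obtain ⟨rfl, rfl⟩ | ⟨rfl, rfl⟩ := Sym2.eq_iff.1 heq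
  · rfl
  · exact absurd hcd.2 (Finset.disjoint_left.1 h hab.1)

lemma not_isDiag_of_mem_pairsBetween (h : Disjoint S T) {e : Sym2 V}
    (he : e ∈ pairsBetween S T) : ¬ e.IsDiag := by
  obtain ⟨a, ha, b, hb, rfl⟩ := mem_pairsBetween.1 he
  simpa using fun hab : a = b => Finset.disjoint_left.1 h ha (hab ▸ hb)

end Pairs

lemma measureReal_biUnion_finset_le_card_mul {Ω ι : Type*} [MeasurableSpace Ω] (μ : Measure Ω)
    [IsFiniteMeasure μ] (s : Finset ι) (f : ι → Set Ω) {c : ℝ} (h : ∀ i ∈ s, μ.real (f i) ≤ c) :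
    μ.real (⋃ i ∈ s, f i) ≤ s.card * c :=
  (measureReal_biUnion_finset_le s f).trans (by simpa using Finset.sum_le_card_nsmul s _ c h)

section Fintype

variable [Fintype V] [DecidableEq V]

lemma exists_cut_of_not_connected {G : SimpleGraph V} (hV : 0 < Fintype.card V)
    (hG : ¬ G.Connected) : ∃ U : Finset V, 1 ≤ U.card ∧ U.card ≤ Fintype.card V / 2 ∧
      ∀ e ∈ pairsBetween U Uᶜ, e ∉ G.edgeSet := by
  classical
  have : Nonempty V := Fintype.card_pos_iff.1 hV
  have hpre : ¬ G.Preconnected := fun h => hG ⟨h⟩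
  rw [Preconnected] at hpre
  push Not at hpre
  obtain ⟨a, b, hab⟩ := hpre
  let U : Finset V := {x | G.Reachable a x}
  have hU : ∀ x ∈ U, ∀ y ∉ U, ¬ G.Adj x y := by
    intro x hx y hy hxy
    simp only [U, Finset.mem_filter, Finset.mem_univ, true_and] at hx hy
    exact hy (hx.trans hxy.reachable)
  have ha : a ∈ U := by simp [U]
  have hb : b ∉ U := by simpa [U] using hab
  have h₁ : 1 ≤ U.card := Finset.card_pos.2 ⟨a, ha⟩
  have h₂ : 1 ≤ Uᶜ.card := Finset.card_pos.2 ⟨b, by simpa using hb⟩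
  have h₃ := Finset.card_add_card_compl U
  by_cases h : U.card ≤ Fintype.card V / 2
  · refine ⟨U, h₁, h, fun e he => ?_⟩
    obtain ⟨x, hx, y, hy, rfl⟩ := mem_pairsBetween.1 he
    exact hU x hx y (by simpa using hy)
  · refine ⟨Uᶜ, h₂, by omega, fun e he => ?_⟩
    obtain ⟨x, hx, y, hy, rfl⟩ := mem_pairsBetween.1 he
    rw [compl_compl] at hy
    exact fun h => hU y hy x (by simpa using hx) h.symm

theorem binomialRandom_real_not_connected_le (p : I) (hV : 0 < Fintype.card V) :
    (binomialRandom V p).real {G | ¬ G.Connected} ≤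
      ∑ k ∈ Finset.Icc 1 (Fintype.card V / 2), ((Fintype.card V).choose k : ℝ) *
        (1 - p : ℝ) ^ (k * (Fintype.card V - k)) := by
  have hsub : {G : SimpleGraph V | ¬ G.Connected} ⊆
      ⋃ k ∈ Finset.Icc 1 (Fintype.card V / 2), ⋃ U ∈ Finset.powersetCard k Finset.univ,
        {G | (∀ e ∈ (∅ : Finset (Sym2 V)), e ∈ G.edgeSet) ∧
          ∀ e ∈ pairsBetween U Uᶜ, e ∉ G.edgeSet} := by
    intro G hG
    obtain ⟨U, h₁, h₂, h₃⟩ := exists_cut_of_not_connected hV hG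
    simp only [Set.mem_iUnion]
    exact ⟨U.card, Finset.mem_Icc.2 ⟨h₁, h₂⟩, U, by simp, by simp, h₃⟩
  refine (measureReal_mono hsub (measure_ne_top _ _)).trans ((measureReal_biUnion_finset_le _ _).trans
    (Finset.sum_le_sum fun k _ => ?_))
  rw [← Finset.card_univ (α := V), ← Finset.card_powersetCard]
  refine measureReal_biUnion_finset_le_card_mul _ _ _ fun U hU => ?_
  obtain ⟨-, rfl⟩ := Finset.mem_powersetCard.1 hU
  rw [binomialRandom_real_cylinder p (Finset.disjoint_empty_left _) (by simp)
    fun e he => not_isDiag_of_mem_pairsBetween disjoint_compl_right he,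
    card_pairsBetween disjoint_compl_right, Finset.card_compl]
  simp

/-- The vertex `z` separates the set `U`, and `s(z, a)` and `s(b, w)` are two distinct edges
within `U ∪ {z}`. -/
def IsSeparatedBy (G : SimpleGraph V) (z : V) (U : Finset V) (a b w : V) : Prop :=
  z ∉ U ∧ a ∈ U ∧ b ∈ U ∧ a ≠ b ∧ w ∈ insert z U ∧ w ≠ b ∧ G.Adj z a ∧ G.Adj b w ∧
    ∀ e ∈ pairsBetween U (insert z U)ᶜ, e ∉ G.edgeSet

/-- A walk from `U` to `z` can leave `U` only into `z`, which gives `a`. Any other vertex `b` of `U`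
has a neighbour, necessarily in `U ∪ {z}`. The edges differ because `b` is neither `z` nor `a`; they
supply the factor p². -/
lemma exists_isSeparatedBy_of_connected {G : SimpleGraph V} (hG : G.Connected) {z : V}
    {U : Finset V} (hz : z ∉ U) (h2 : 2 ≤ U.card)
    (hU : ∀ a ∈ U, ∀ b ∉ U, b ≠ z → ¬ G.Adj a b) :
    ∃ a ∈ U, ∃ b ∈ U, ∃ w ∈ insert z U, G.IsSeparatedBy z U a b w := by
  have hmem : ∀ a ∈ U, ∀ b, G.Adj a b → b ∈ insert z U := by
    intro a ha b hab
    by_contra hb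
    simp only [Finset.mem_insert, not_or] at hb
    exact hU a ha b hb.2 hb.1 hab
  obtain ⟨a, ha, hza⟩ : ∃ a ∈ U, G.Adj z a := by
    by_contra! hcon
    obtain ⟨c, hc⟩ := Finset.card_pos.1 (by omega : 0 < U.card)
    obtain ⟨W⟩ := hG.preconnected c z
    obtain ⟨d, -, hd, hd'⟩ := W.exists_boundary_dart (U : Set V) hc hz
    have := hmem _ hd _ d.adj
    simp only [Finset.mem_insert] at this
    obtain h | h := this
    · exact hcon _ hd (h ▸ d.adj.symm)
    · exact hd' h
  obtain ⟨b, hb, hba⟩ := Finset.exists_mem_ne (by omega : 1 < U.card) a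
  have : Nontrivial V := ⟨a, b, hba.symm⟩
  obtain ⟨w, hw⟩ := hG.preconnected.exists_adj_of_nontrivial b
  refine ⟨a, ha, b, hb, w, hmem b hb w hw, hz, ha, hb, hba.symm, hmem b hb w hw, hw.ne.symm, hza,
    hw, fun e he => ?_⟩
  obtain ⟨x, hx, y, hy, rfl⟩ := mem_pairsBetween.1 he
  simp only [Finset.mem_compl, Finset.mem_insert, not_or] at hy
  exact hU x hx y hy.2 hy.1

lemma binomialRandom_real_isSeparatedBy_le (p : I) (z : V) (U : Finset V) (a b w : V) :
    (binomialRandom V p).real {G | G.IsSeparatedBy z U a b w} ≤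
      (p : ℝ) ^ 2 * (1 - p : ℝ) ^ (U.card * (Fintype.card V - 1 - U.card)) := by
  by_cases h : z ∉ U ∧ a ∈ U ∧ b ∈ U ∧ a ≠ b ∧ w ∈ insert z U ∧ w ≠ b
  swap
  · have : {G : SimpleGraph V | G.IsSeparatedBy z U a b w} = ∅ := by
      ext G
      simp only [Set.mem_ofPred_eq, Set.mem_empty_iff_false, iff_false]
      rintro ⟨h₁, h₂, h₃, h₄, h₅, h₆, -⟩
      exact h ⟨h₁, h₂, h₃, h₄, h₅, h₆⟩
    rw [this, measureReal_empty]
    have := p.2.1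
    have := sub_nonneg.2 p.2.2
    positivity
  obtain ⟨hz, ha, hb, hab, hw, hwb⟩ := h
  have hza : z ≠ a := fun h => hz (h ▸ ha)
  have hzb : z ≠ b := fun h => hz (h ▸ hb)
  have hdisj : Disjoint U (insert z U)ᶜ := by
    rw [Finset.disjoint_left]
    intro x hx
    simp [hx]
  have hne : s(z, a) ≠ s(b, w) := by
    rw [Ne, Sym2.eq_iff]
    rintro (⟨h, -⟩ | ⟨-, h⟩)
    · exact hzb h
    · exact hab h
  have hin : ∀ x ∈ insert z U, ∀ y ∈ insert z U, s(x, y) ∉ pairsBetween U (insert z U)ᶜ := by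
    intro x hx y hy hxy
    obtain ⟨c, hc, d, hd, hcd⟩ := mem_pairsBetween.1 hxy
    rw [Finset.mem_compl] at hd
    obtain ⟨rfl, rfl⟩ | ⟨rfl, rfl⟩ := Sym2.eq_iff.1 hcd
    · exact hd hy
    · exact hd hx
  have hAB : Disjoint ({s(z, a), s(b, w)} : Finset (Sym2 V)) (pairsBetween U (insert z U)ᶜ) := by
    rw [Finset.disjoint_left]
    intro e he
    simp only [Finset.mem_insert, Finset.mem_singleton] at he
    obtain rfl | rfl := he
    · exact hin _ (Finset.mem_insert_self _ _) _ (Finset.mem_insert_of_mem ha)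
    · exact hin _ (Finset.mem_insert_of_mem hb) _ hw
  have hcyl := binomialRandom_real_cylinder p hAB
    (by
      intro e he
      simp only [Finset.mem_insert, Finset.mem_singleton] at he
      obtain rfl | rfl := he
      · simpa using hza
      · simpa using hwb.symm)
    fun e he => not_isDiag_of_mem_pairsBetween hdisj he
  rw [card_pairsBetween hdisj, Finset.card_pair hne, Finset.card_compl,
    Finset.card_insert_of_notMem hz, Nat.add_comm, ← Nat.sub_sub] at hcyl
  rw [← hcyl]
  refine measureReal_mono ?_
  rintro G ⟨-, -, -, -, -, -, h₁, h₂, h₃⟩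
  exact ⟨by simp [h₁, h₂], h₃⟩

theorem binomialRandom_real_connected_lt_conflictFreeConnectionNumber_le (p : I)
    (hV : 5 ≤ Fintype.card V) :
    (binomialRandom V p).real {G | G.Connected ∧ ¬ G.conflictFreeConnectionNumber ≤ 2} ≤
      ∑ k ∈ Finset.Icc 2 ((Fintype.card V - 1) / 2), (Fintype.card V : ℝ) *
        (((Fintype.card V).choose k : ℝ) * ((k : ℝ) * (k * ((k + 1 : ℕ) *
          ((p : ℝ) ^ 2 * (1 - p : ℝ) ^ (k * (Fintype.card V - 1 - k))))))) := by
  have hsub : {G : SimpleGraph V | G.Connected ∧ ¬ G.conflictFreeConnectionNumber ≤ 2} ⊆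
      ⋃ k ∈ Finset.Icc 2 ((Fintype.card V - 1) / 2), ⋃ z ∈ (Finset.univ : Finset V),
        ⋃ U ∈ Finset.powersetCard k ({z}ᶜ : Finset V), ⋃ a ∈ U, ⋃ b ∈ U, ⋃ w ∈ insert z U,
          {G | G.IsSeparatedBy z U a b w} := by
    rintro G ⟨hG, hcfc⟩
    have key : ∃ z, ∃ U : Finset V, z ∉ U ∧ 2 ≤ U.card ∧ U.card ≤ (Fintype.card V - 1) / 2 ∧
        ∀ a ∈ U, ∀ b ∉ U, b ≠ z → ¬ G.Adj a b := by
      by_contra! hcon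
      refine hcfc (conflictFreeConnectionNumber_le_two_of_expanding hG hV fun z U hz h2 h3 => ?_)
      by_cases h : U.card ≤ (Fintype.card V - 1) / 2
      · exact hcon z U hz h2 h
      have hcard : (insert z U)ᶜ.card = Fintype.card V - (U.card + 1) := by
        rw [Finset.card_compl, Finset.card_insert_of_notMem hz]
      -- A large `U` is traded for the other side of the separation by `z`; |U| ≤ n - 3 leaves at
      -- least two vertices there.
      obtain ⟨a, ha, b, hb, hbz, hab⟩ := hcon z (insert z U)ᶜ (by simp) (by omega) (by omega)
      simp only [Finset.mem_compl, Finset.mem_insert, not_or, not_not, not_and] at ha hb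
      refine ⟨b, ?_, a, ha.2, ha.1, hab.symm⟩
      by_contra hbU
      exact hbU (hb hbz)
    obtain ⟨z, U, hz, h2, h3, hU⟩ := key
    obtain ⟨a, ha, b, hb, w, hw, h⟩ := exists_isSeparatedBy_of_connected hG hz h2 hU
    simp only [Set.mem_iUnion]
    exact ⟨U.card, Finset.mem_Icc.2 ⟨h2, h3⟩, z, Finset.mem_univ _, U, by simp [hz], a, ha,
      b, hb, w, hw, h⟩
  refine (measureReal_mono hsub (measure_ne_top _ _)).trans ((measureReal_biUnion_finset_le _ _).trans
    (Finset.sum_le_sum fun k _ => ?_))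
  have hp := p.2.1
  have hq := sub_nonneg.2 p.2.2
  refine measureReal_biUnion_finset_le_card_mul _ _ _ fun z _ => ?_
  refine (measureReal_biUnion_finset_le_card_mul (c := (k : ℝ) * (k * ((k + 1 : ℕ) *
          ((p : ℝ) ^ 2 * (1 - p : ℝ) ^ (k * (Fintype.card V - 1 - k)))))) _ _ _
    fun U hU => ?_).trans ?_
  · obtain ⟨hz, rfl⟩ := Finset.mem_powersetCard.1 hU
    have hz : z ∉ U := fun h => by simpa using hz h
    refine measureReal_biUnion_finset_le_card_mul _ _ _ fun a _ => ?_
    refine measureReal_biUnion_finset_le_card_mul _ _ _ fun b _ => ?_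
    rw [← Finset.card_insert_of_notMem hz]
    refine measureReal_biUnion_finset_le_card_mul _ _ _ fun w _ => ?_
    exact binomialRandom_real_isSeparatedBy_le p z U a b w
  · rw [← Finset.card_univ (α := V), ← Finset.card_powersetCard]
    gcongr
    exact Finset.powersetCard_mono (Finset.subset_univ _)

end Fintype

end SimpleGraph

/-! ### Estimates for the first-moment sums -/

section

open Real

/-- A summable majorant of `n ^ (k ^ 2 / n) / k !` for `2 * k ≤ n`. -/
noncomputable def cutWeight (k : ℕ) : ℝ := exp (k * log (2 * k) / 2) / k.factorial

lemma cutWeight_nonneg (k : ℕ) : 0 ≤ cutWeight k := by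
  unfold cutWeight
  positivity

/-- Squaring removes the half-integer power: what remains is `k ^ k ≤ e ^ k * k!`. -/
lemma cutWeight_sq_le (k : ℕ) : cutWeight k ^ 2 ≤ (2 * exp 1) ^ k / k.factorial := by
  have hf : (0 : ℝ) < k.factorial := by positivity
  have h₁ : exp (k * log (2 * k) / 2) ^ 2 ≤ 2 ^ k * (k : ℝ) ^ k := by
    rw [← exp_nat_mul]
    obtain rfl | hk := Nat.eq_zero_or_pos k
    · simp
    · have hk' : (0 : ℝ) < k := by exact_mod_cast hk
      rw [← mul_pow, ← exp_log (by positivity : (0 : ℝ) < 2 * k), ← exp_nat_mul, log_exp]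
      apply le_of_eq
      congr 1
      push_cast
      ring
  have h₂ : (k : ℝ) ^ k ≤ exp 1 ^ k * k.factorial := by
    rw [← exp_nat_mul, mul_one, ← div_le_iff₀ hf]
    exact pow_div_factorial_le_exp _ (Nat.cast_nonneg _) _
  rw [cutWeight, div_pow, div_le_div_iff₀ (by positivity) hf]
  calc exp (k * log (2 * k) / 2) ^ 2 * k.factorial
      ≤ 2 ^ k * (exp 1 ^ k * k.factorial) * k.factorial := by
        gcongr
        exact h₁.trans (by gcongr)
    _ = (2 * exp 1) ^ k * (k.factorial : ℝ) ^ 2 := by rw [mul_pow]; ring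

lemma summable_pow_mul_cutWeight (r : ℝ) : Summable fun k => r ^ k * cutWeight k := by
  -- The majorant comes from x ≤ 2^k x² + 2^(-k), a form of AM-GM, which reduces to the bound on the
  -- square.
  refine Summable.of_norm_bounded (g := fun k : ℕ =>
    (4 * r ^ 2 * exp 1) ^ k / k.factorial + (1 / 2) ^ k)
    ((summable_pow_div_factorial _).add summable_geometric_two) fun k => ?_
  have h := mul_le_mul_of_nonneg_left (cutWeight_sq_le k)
    (by positivity : (0 : ℝ) ≤ 2 ^ k * (r ^ k) ^ 2)
  have h₁ : (2 : ℝ) ^ k * (r ^ k) ^ 2 * ((2 * exp 1) ^ k / k.factorial) =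
      (4 * r ^ 2 * exp 1) ^ k / k.factorial := by
    rw [← pow_mul, mul_comm k 2, pow_mul, ← mul_pow, ← mul_div_assoc, ← mul_pow]
    congr 2
    ring
  rw [h₁] at h
  have h₂ : (1 / 2 : ℝ) ^ k * 2 ^ k = 1 := by rw [← mul_pow]; norm_num
  rw [norm_eq_abs]
  have h₃ : (2 : ℝ) ^ k * (r ^ k) ^ 2 * cutWeight k ^ 2 =
      2 ^ k * |r ^ k * cutWeight k| ^ 2 := by rw [sq_abs]; ring
  rw [h₃] at h
  refine le_trans ?_ (add_le_add_left h _)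
  set x := |r ^ k * cutWeight k|
  have h₄ : (0 : ℝ) ≤ 2 ^ k * (x - (1 / 2) ^ k) ^ 2 := by positivity
  have h₅ : (0 : ℝ) ≤ 2 ^ k * x ^ 2 := by positivity
  have h₆ : (0 : ℝ) ≤ (1 / 2) ^ k := by positivity
  have h₇ : (2 : ℝ) ^ k * (x - (1 / 2) ^ k) ^ 2 =
      2 ^ k * x ^ 2 - 2 * x * ((1 / 2) ^ k * 2 ^ k) + (1 / 2) ^ k * ((1 / 2) ^ k * 2 ^ k) := by ring
  rw [h₂] at h₇
  linarith

/-- The function log x / x decreases only from e on. For `k = 1` the point 2 lies below e, but log 2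
/ 2 = log 4 / 4, hence `4 ≤ n`. -/
lemma log_div_self_le {k n : ℕ} (hk : 1 ≤ k) (hkn : 2 * k ≤ n) (hn : 4 ≤ n) :
    log n / n ≤ log (2 * k) / (2 * k) := by
  have he : exp 1 ≤ 4 := exp_one_lt_three.le.trans (by norm_num)
  have hn' : (4 : ℝ) ≤ n := by exact_mod_cast hn
  obtain rfl | hk := hk.eq_or_lt
  · have h := log_div_self_antitoneOn (by simpa using he : (4 : ℝ) ∈ {x | exp 1 ≤ x})
      (by simpa using he.trans hn') hn'
    refine h.trans (le_of_eq ?_)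
    simp only [Nat.cast_one, mul_one]
    rw [show (4 : ℝ) = 2 ^ 2 by norm_num, log_pow]
    push_cast
    ring
  · have hk' : (4 : ℝ) ≤ 2 * k := by
      have : (2 : ℝ) ≤ k := by exact_mod_cast hk
      linarith
    have hkn' : (2 * k : ℝ) ≤ n := by exact_mod_cast hkn
    exact log_div_self_antitoneOn (by simpa using he.trans hk')
      (by simpa using he.trans hn') hkn'

lemma sq_mul_log_div_le {k n : ℕ} (hk : 1 ≤ k) (hkn : 2 * k ≤ n) (hn : 4 ≤ n) :
    (k : ℝ) ^ 2 * (log n / n) ≤ k * log (2 * k) / 2 := by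
  have hk' : (0 : ℝ) < k := by exact_mod_cast hk
  calc (k : ℝ) ^ 2 * (log n / n) ≤ (k : ℝ) ^ 2 * (log (2 * k) / (2 * k)) := by
        exact mul_le_mul_of_nonneg_left (log_div_self_le hk hkn hn) (sq_nonneg _)
    _ = k * log (2 * k) / 2 := by field_simp

lemma one_sub_pow_le_exp {p : ℝ} (hp : p ≤ 1) (m : ℕ) : (1 - p) ^ m ≤ exp (-(p * m)) := by
  rw [show -(p * m) = m * -p by ring, exp_nat_mul]
  exact pow_le_pow_left₀ (by linarith) (one_sub_le_exp_neg p) m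

lemma choose_mul_exp_le {n k : ℕ} (hn : 0 < n) {t s : ℝ}
    (h : k * log n + t ≤ k * log (2 * k) / 2 + s) :
    (n.choose k : ℝ) * exp t ≤ exp s * cutWeight k := by
  have hn' : (0 : ℝ) < n := by exact_mod_cast hn
  calc (n.choose k : ℝ) * exp t ≤ (n : ℝ) ^ k / k.factorial * exp t := by
        gcongr
        exact Nat.choose_le_pow_div k n
    _ = exp (k * log n + t) / k.factorial := by
        rw [exp_add, exp_nat_mul, exp_log hn']
        ring
    _ ≤ exp (k * log (2 * k) / 2 + s) / k.factorial := by gcongr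
    _ = exp s * cutWeight k := by
        rw [cutWeight, exp_add]
        ring

lemma choose_mul_pow_le {n k : ℕ} {p a : ℝ} (ha : 0 ≤ a) (hp : p ≤ 1)
    (hpn : (log n + a) / n ≤ p) (hk : 1 ≤ k) (hkn : 2 * k ≤ n) (hn : 4 ≤ n) :
    (n.choose k : ℝ) * (1 - p) ^ (k * (n - k)) ≤ exp (-(a / 2)) * cutWeight k := by
  have hn' : (0 : ℝ) < n := by exact_mod_cast (by omega : 0 < n)
  have hk' : (1 : ℝ) ≤ k := by exact_mod_cast hk
  have hkn' : (2 * k : ℝ) ≤ n := by exact_mod_cast hkn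
  refine (mul_le_mul_of_nonneg_left (one_sub_pow_le_exp hp _) (Nat.cast_nonneg _)).trans
    (choose_mul_exp_le (by omega) ?_)
  rw [Nat.cast_mul, Nat.cast_sub (by omega)]
  have h₁ : (log n + a) / n * (k * (n - k)) ≤ p * (k * (n - k)) :=
    mul_le_mul_of_nonneg_right hpn (by nlinarith)
  have h₂ : (log n + a) / n * (k * (n - k)) =
      k * log n - (k : ℝ) ^ 2 * (log n / n) + a * (k * ((n - k) / n)) := by
    field_simp
  have h₃ := sq_mul_log_div_le hk hkn hn
  have h₄ : (1 / 2 : ℝ) ≤ k * ((n - k) / n) := by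
    have : (1 / 2 : ℝ) ≤ (n - k) / n := by
      rw [div_le_div_iff₀ (by norm_num) hn']
      linarith
    nlinarith
  have h₅ : a * (1 / 2) ≤ a * (k * ((n - k) / n)) := mul_le_mul_of_nonneg_left h₄ ha
  linarith

/-- The function x² exp(-xm) decreases for x ≥ 2/m. This reduces all larger `p` to p₀ = log n / n,
despite the growing factor p². -/
lemma sq_mul_exp_neg_le {p₀ p m : ℝ} (hp₀ : 0 < p₀) (hp : p₀ ≤ p) (hm : 2 ≤ p₀ * m) :
    p ^ 2 * exp (-(p * m)) ≤ p₀ ^ 2 * exp (-(p₀ * m)) := by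
  have h₁ : p ≤ p₀ * exp ((p - p₀) / p₀) := by
    have := add_one_le_exp ((p - p₀) / p₀)
    calc p = p₀ * ((p - p₀) / p₀ + 1) := by field_simp; ring
      _ ≤ _ := by gcongr
  have h₂ : 2 * ((p - p₀) / p₀) ≤ (p - p₀) * m := by
    rw [← mul_div_assoc, div_le_iff₀ hp₀]
    nlinarith
  calc p ^ 2 * exp (-(p * m)) ≤ (p₀ * exp ((p - p₀) / p₀)) ^ 2 * exp (-(p * m)) := by
        gcongr
        linarith
    _ = p₀ ^ 2 * exp (2 * ((p - p₀) / p₀) - p * m) := by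
        rw [mul_pow, ← exp_nat_mul, mul_assoc, ← exp_add, Nat.cast_two, sub_eq_add_neg (2 * _)]
    _ ≤ p₀ ^ 2 * exp (-(p₀ * m)) := by
        gcongr
        linarith

lemma sq_mul_choose_mul_pow_le {n k : ℕ} {p : ℝ} (hp : p ≤ 1) (hpn : log n / n ≤ p)
    (hk : 2 ≤ k) (hkn : 2 * k + 1 ≤ n) (hlog : 4 ≤ log n) :
    (n.choose k : ℝ) * (p ^ 2 * (1 - p) ^ (k * (n - 1 - k))) ≤
      (log n / n) ^ 2 * (2 ^ k * cutWeight k) := by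
  have hn' : (5 : ℝ) ≤ n := by exact_mod_cast (by omega : 5 ≤ n)
  have hk' : (2 : ℝ) ≤ k := by exact_mod_cast hk
  have hkn' : (2 * k + 1 : ℝ) ≤ n := by exact_mod_cast hkn
  have hp₀ : 0 < log n / n := by positivity
  have hm : ((k * (n - 1 - k) : ℕ) : ℝ) = k * (n - 1 - k) := by
    rw [Nat.cast_mul, Nat.cast_sub (by omega), Nat.cast_sub (by omega), Nat.cast_one]
  -- Since k(n - 1 - k) ≥ n/2, the product is at least log n / 2; this is where `4 ≤ log n` enters.
  have h₁ : 2 ≤ log n / n * ((k * (n - 1 - k) : ℕ) : ℝ) := by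
    rw [hm, div_mul_eq_mul_div, le_div_iff₀ (by linarith)]
    have : (n : ℝ) / 2 ≤ k * (n - 1 - k) := by nlinarith
    nlinarith
  calc (n.choose k : ℝ) * (p ^ 2 * (1 - p) ^ (k * (n - 1 - k)))
      ≤ n.choose k * (p ^ 2 * exp (-(p * ((k * (n - 1 - k) : ℕ) : ℝ)))) := by
        gcongr
        exact one_sub_pow_le_exp hp _
    _ ≤ n.choose k * ((log n / n) ^ 2 * exp (-(log n / n * ((k * (n - 1 - k) : ℕ) : ℝ)))) := by
        gcongr ?_ * ?_
        exact sq_mul_exp_neg_le hp₀ hpn h₁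
    _ = (log n / n) ^ 2 * (n.choose k * exp (-(log n / n * ((k * (n - 1 - k) : ℕ) : ℝ)))) := by
        ring
    _ ≤ (log n / n) ^ 2 * (exp (k * log 2) * cutWeight k) := by
        gcongr ?_ * ?_
        refine choose_mul_exp_le (by omega) ?_
        have h₂ := sq_mul_log_div_le (by omega : 1 ≤ k) (by omega : 2 * k ≤ n) (by omega)
        have h₃ := log_div_self_le le_rfl (by omega : 2 * 1 ≤ n) (by omega)
        -- The exponent has n - 1 - k instead of n - k; this loss is the origin of the factor `2 ^
        -- k`.
        have h₄ : k * (log n / n) ≤ k * log 2 := by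
          gcongr
          refine h₃.trans ?_
          have := log_pos one_lt_two
          norm_num
          linarith
        have h₅ : log n / n * (k * (n - 1 - k)) =
            k * log n - k * (log n / n) - (k : ℝ) ^ 2 * (log n / n) := by
          field_simp
        rw [hm, h₅]
        linarith
    _ = _ := by rw [exp_nat_mul, exp_log two_pos]

/-- Absorbs the number of choices of `a`, `b`, `w` into a geometric factor, harmless against
`cutWeight`. -/
lemma cube_le_eight_pow (k : ℕ) : (k : ℝ) * (k * (k + 1 : ℕ)) ≤ 8 ^ k := by
  have h : k + 1 ≤ 2 ^ k := Nat.lt_two_pow_self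
  have h' : k * (k * (k + 1)) ≤ 8 ^ k := by
    calc k * (k * (k + 1)) ≤ 2 ^ k * (2 ^ k * 2 ^ k) := by gcongr <;> omega
      _ = 8 ^ k := by rw [← mul_pow, ← mul_pow]; norm_num
  exact_mod_cast h'

namespace SimpleGraph

open MeasureTheory unitInterval

lemma binomialRandom_real_not_connected_le_exp {n : ℕ} {p : I} {a : ℝ} (ha : 0 ≤ a)
    (hpn : (log n + a) / n ≤ p) (hn : 4 ≤ n) :
    (binomialRandom (Fin n) p).real {G | ¬ G.Connected} ≤
      exp (-(a / 2)) * ∑' k, cutWeight k := by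
  have hs : Summable cutWeight := by simpa using summable_pow_mul_cutWeight 1
  refine (binomialRandom_real_not_connected_le p (by simp; omega)).trans ?_
  rw [Fintype.card_fin]
  calc _ ≤ ∑ k ∈ Finset.Icc 1 (n / 2), exp (-(a / 2)) * cutWeight k := by
        refine Finset.sum_le_sum fun k hk => ?_
        rw [Finset.mem_Icc] at hk
        exact choose_mul_pow_le ha p.2.2 hpn hk.1 (by omega) hn
    _ ≤ _ := by
        rw [← Finset.mul_sum]
        gcongr
        exact hs.sum_le_tsum _ fun k _ => cutWeight_nonneg k

lemma binomialRandom_real_connected_lt_le_log {n : ℕ} {p : I} (hpn : log n / n ≤ p)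
    (hlog : 4 ≤ log n) (hn : 5 ≤ n) :
    (binomialRandom (Fin n) p).real {G | G.Connected ∧ ¬ G.conflictFreeConnectionNumber ≤ 2} ≤
      log n ^ 2 / n * ∑' k, 16 ^ k * cutWeight k := by
  have hs := summable_pow_mul_cutWeight 16
  have hn' : (0 : ℝ) < n := by exact_mod_cast (by omega : 0 < n)
  refine (binomialRandom_real_connected_lt_conflictFreeConnectionNumber_le p (by simpa)).trans ?_
  rw [Fintype.card_fin]
  calc _ ≤ ∑ k ∈ Finset.Icc 2 ((n - 1) / 2), log n ^ 2 / n * (16 ^ k * cutWeight k) := by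
        refine Finset.sum_le_sum fun k hk => ?_
        rw [Finset.mem_Icc] at hk
        have h := sq_mul_choose_mul_pow_le p.2.2 hpn hk.1 (by omega) hlog
        have hw := cutWeight_nonneg k
        calc _ = (n : ℝ) * ((k * (k * (k + 1 : ℕ))) * ((n.choose k : ℝ) *
                ((p : ℝ) ^ 2 * (1 - p) ^ (k * (n - 1 - k))))) := by ring
          _ ≤ n * (8 ^ k * ((log n / n) ^ 2 * (2 ^ k * cutWeight k))) := by
              gcongr ?_ * ?_
              exact mul_le_mul (cube_le_eight_pow k) h (mul_nonneg (Nat.cast_nonneg _)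
                (mul_nonneg (sq_nonneg _) (pow_nonneg (sub_nonneg.2 p.2.2) _))) (by positivity)
          _ = _ := by
              rw [show (16 : ℝ) = 8 * 2 by norm_num, mul_pow]
              field_simp
    _ ≤ _ := by
        rw [← Finset.mul_sum]
        gcongr
        exact hs.sum_le_tsum _ fun k _ => mul_nonneg (by positivity) (cutWeight_nonneg k)

end SimpleGraph

end

/-! ### Isolated vertices below the threshold -/

section

open Real MeasureTheory

/-- The second moment method for a family of events of equal probability `a`. -/
lemma sq_mul_measureReal_forall_notMem_le {Ω ι : Type*} [MeasurableSpace Ω] [DecidableEq ι]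
    {μ : Measure Ω} [IsProbabilityMeasure μ] (s : Finset ι) {A : ι → Set Ω}
    (hA : ∀ i, MeasurableSet (A i)) {a b : ℝ} (ha : ∀ i ∈ s, μ.real (A i) = a)
    (hb : ∀ i ∈ s, ∀ j ∈ s, i ≠ j → μ.real (A i ∩ A j) ≤ b) :
    (s.card * a) ^ 2 * μ.real {ω | ∀ i ∈ s, ω ∉ A i} ≤
      s.card * a + s.card * (s.card - 1) * b - (s.card * a) ^ 2 := by
  set c : ℝ := s.card * a with hc
  set E : Set Ω := {ω | ∀ i ∈ s, ω ∉ A i} with hE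
  have hEm : MeasurableSet E := by
    have : E = ⋂ i ∈ s, (A i)ᶜ := by ext; simp [hE]
    rw [this]
    exact Finset.measurableSet_biInter _ fun i _ => (hA i).compl
  let f : Set Ω → Ω → ℝ := fun S => S.indicator 1
  have hfi : ∀ S, MeasurableSet S → Integrable (f S) μ := fun S hS =>
    (integrable_const (1 : ℝ)).indicator hS
  have hf : ∀ S, MeasurableSet S → ∫ ω, f S ω ∂μ = μ.real S := fun S hS =>
    integral_indicator_one hS
  have hfAA : ∀ ω, (∑ i ∈ s, f (A i) ω) ^ 2 = ∑ i ∈ s, ∑ j ∈ s, f (A i ∩ A j) ω := by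
    intro ω
    rw [sq, Finset.sum_mul_sum]
    refine Finset.sum_congr rfl fun i _ => Finset.sum_congr rfl fun j _ => ?_
    simp only [f, Set.inter_indicator_one, Pi.mul_apply]
  -- Chebyshev's argument pointwise: with X the number of events that occur, the right side is (X -
  -- c)², and X = 0 on `E`.
  have hpt : ∀ ω, c ^ 2 * f E ω ≤
      ((∑ i ∈ s, ∑ j ∈ s, f (A i ∩ A j) ω) - 2 * c * ∑ i ∈ s, f (A i) ω) + c ^ 2 := by
    intro ω
    rw [← hfAA]
    by_cases hω : ω ∈ E
    · have h₀ : ∑ i ∈ s, f (A i) ω = 0 := Finset.sum_eq_zero fun i hi => by simp [f, hω i hi]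
      simp [f, hω, h₀]
    · have : f E ω = 0 := by simp [f, hω]
      rw [this]
      nlinarith [sq_nonneg (∑ i ∈ s, f (A i) ω - c)]
  have hi₁ : Integrable (fun ω => ∑ i ∈ s, ∑ j ∈ s, f (A i ∩ A j) ω) μ :=
    integrable_finsetSum _ fun i _ => integrable_finsetSum _ fun j _ =>
      hfi _ ((hA i).inter (hA j))
  have hi₂ : Integrable (fun ω => 2 * c * ∑ i ∈ s, f (A i) ω) μ :=
    (integrable_finsetSum _ fun i _ => hfi _ (hA i)).const_mul _
  have hint := integral_mono ((hfi E hEm).const_mul (c ^ 2))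
    ((hi₁.sub hi₂).add (integrable_const (c ^ 2))) hpt
  rw [integral_const_mul, hf E hEm, integral_add' (hi₁.sub hi₂) (integrable_const _),
    integral_sub' hi₁ hi₂, integral_const_mul, integral_const, probReal_univ, one_smul,
    integral_finsetSum _ fun i _ => hfi _ (hA i),
    integral_finsetSum _ fun i _ => integrable_finsetSum _ fun j _ =>
      hfi _ ((hA i).inter (hA j))] at hint
  have h₁ : ∑ i ∈ s, ∫ ω, f (A i) ω ∂μ = c := by
    rw [Finset.sum_congr rfl fun i hi => (hf _ (hA i)).trans (ha i hi)]
    simp [hc]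
  have h₂ : ∑ i ∈ s, ∫ ω, ∑ j ∈ s, f (A i ∩ A j) ω ∂μ ≤ c + s.card * (s.card - 1) * b := by
    have h₃ : ∀ i ∈ s, ∫ ω, ∑ j ∈ s, f (A i ∩ A j) ω ∂μ ≤ a + (s.card - 1) * b := by
      intro i hi
      rw [integral_finsetSum _ fun j _ => hfi _ ((hA i).inter (hA j)),
        ← Finset.add_sum_erase _ _ hi, hf _ ((hA i).inter (hA i)), Set.inter_self, ha i hi]
      have h₄ := Finset.sum_le_card_nsmul (s.erase i) (fun j => ∫ ω, f (A i ∩ A j) ω ∂μ) b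
        fun j hj => by
          rw [hf _ ((hA i).inter (hA j))]
          exact hb i hi j (Finset.mem_of_mem_erase hj) (Finset.ne_of_mem_erase hj).symm
      rw [nsmul_eq_mul, Finset.card_erase_of_mem hi,
        Nat.cast_sub (Finset.card_pos.2 ⟨i, hi⟩), Nat.cast_one] at h₄
      linarith
    refine (Finset.sum_le_card_nsmul s _ _ h₃).trans (le_of_eq ?_)
    rw [nsmul_eq_mul, hc]
    ring
  rw [h₁] at hint
  linarith

namespace SimpleGraph

open unitInterval

section Fintype

variable {V : Type*} [Fintype V] [DecidableEq V]

theorem binomialRandom_real_no_isolated_le {p : I} (hp : (p : ℝ) < 1) (hV : 2 ≤ Fintype.card V) :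
    (binomialRandom V p).real {G | ∀ v, ∃ w, G.Adj v w} ≤
      ((Fintype.card V : ℝ) * (1 - p) ^ (Fintype.card V - 1))⁻¹ + p / (1 - p) := by
  set q : ℝ := 1 - p with hq
  have hq₀ : 0 < q := by linarith
  set n := Fintype.card V with hn
  have hn₀ : (0 : ℝ) < n := by exact_mod_cast (by omega : 0 < n)
  let A : V → Set (SimpleGraph V) := fun v => {G | (∀ e ∈ (∅ : Finset (Sym2 V)), e ∈ G.edgeSet) ∧
    ∀ e ∈ pairsBetween {v} {v}ᶜ, e ∉ G.edgeSet}
  have hA : ∀ v, (binomialRandom V p).real (A v) = q ^ (n - 1) := by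
    intro v
    have hd : Disjoint ({v} : Finset V) {v}ᶜ := disjoint_compl_right
    rw [binomialRandom_real_cylinder p (Finset.disjoint_empty_left _) (by simp)
      fun e he => not_isDiag_of_mem_pairsBetween hd he, card_pairsBetween hd, Finset.card_compl]
    simp [hq, hn]
  have hAA : ∀ v w, v ≠ w → (binomialRandom V p).real (A v ∩ A w) ≤ q ^ (n - 1 + (n - 2)) := by
    intro v w hvw
    have hd₁ : Disjoint ({v} : Finset V) {v}ᶜ := disjoint_compl_right
    -- Omitting `v` here keeps the pair `vw` from being counted twice, so 2n - 3 pairs are absent.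
    have hd₂ : Disjoint ({w} : Finset V) {v, w}ᶜ := by simp
    have hd : Disjoint (pairsBetween {v} {v}ᶜ) (pairsBetween {w} {v, w}ᶜ) := by
      rw [Finset.disjoint_left]
      intro e he he'
      obtain ⟨a, ha, b, hb, rfl⟩ := mem_pairsBetween.1 he
      obtain ⟨c, hc, d, hd, hcd⟩ := mem_pairsBetween.1 he'
      simp only [Finset.mem_singleton, Finset.mem_compl, Finset.mem_insert, not_or] at ha hc hd
      subst ha hc
      obtain ⟨h, -⟩ | ⟨-, h⟩ := Sym2.eq_iff.1 hcd
      · exact hvw h.symm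
      · exact hd.1 h
    have hcyl := binomialRandom_real_cylinder p (Finset.disjoint_empty_left
      (pairsBetween {v} {v}ᶜ ∪ pairsBetween {w} {v, w}ᶜ)) (by simp) (by
        intro e he
        obtain he | he := Finset.mem_union.1 he
        · exact not_isDiag_of_mem_pairsBetween hd₁ he
        · exact not_isDiag_of_mem_pairsBetween hd₂ he)
    rw [Finset.card_union_of_disjoint hd, card_pairsBetween hd₁, card_pairsBetween hd₂,
      Finset.card_compl, Finset.card_compl, Finset.card_pair hvw, Finset.card_singleton,
      Finset.card_singleton, one_mul, one_mul, Finset.card_empty, pow_zero, one_mul] at hcyl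
    rw [hq, hn, ← hcyl]
    refine measureReal_mono ?_ (measure_ne_top _ _)
    rintro G ⟨⟨-, h₁⟩, -, h₂⟩
    refine ⟨by simp, fun e he => ?_⟩
    obtain he | he := Finset.mem_union.1 he
    · exact h₁ e he
    · obtain ⟨a, ha, b, hb, rfl⟩ := mem_pairsBetween.1 he
      simp only [Finset.mem_compl, Finset.mem_insert, not_or] at hb
      exact h₂ _ (mem_pairsBetween.2 ⟨a, ha, b, by simpa using hb.2, rfl⟩)
  have hsub : {G : SimpleGraph V | ∀ v, ∃ w, G.Adj v w} ⊆
      {G | ∀ v ∈ (Finset.univ : Finset V), G ∉ A v} := by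
    rintro G hG v - ⟨-, hv⟩
    obtain ⟨w, hw⟩ := hG v
    exact hv s(v, w) (mem_pairsBetween.2 ⟨v, by simp, w, by simpa using hw.ne.symm, rfl⟩) hw
  refine (measureReal_mono hsub (measure_ne_top _ _)).trans ?_
  have h := sq_mul_measureReal_forall_notMem_le (μ := binomialRandom V p) Finset.univ (A := A)
    (fun v => (Set.toFinite _).measurableSet) (fun v _ => hA v) (fun v _ w _ => hAA v w)
  rw [Finset.card_univ, ← hn] at h
  set P := (binomialRandom V p).real {G | ∀ v ∈ (Finset.univ : Finset V), G ∉ A v}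
  obtain ⟨m, hm⟩ : ∃ m, n = m + 2 := ⟨n - 2, by omega⟩
  rw [show n - 1 + (n - 2) = m + 1 + m by omega, show n - 1 = m + 1 by omega] at h
  rw [show n - 1 = m + 1 by omega]
  have hpos : (0 : ℝ) < (n * q ^ (m + 1)) ^ 2 := by positivity
  rw [mul_comm, ← le_div_iff₀ hpos] at h
  refine h.trans ?_
  have hpq : (p : ℝ) = 1 - q := by rw [hq]; ring
  -- The pair term is at most n² q^(2n-3) / (n q^(n-1))² = 1/q, and subtracting 1 leaves p/q.
  rw [hpq, sub_div, add_div, div_self hpos.ne', add_sub_assoc]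
  refine add_le_add (le_of_eq ?_) ?_
  · field_simp
  · have h₁ : (n : ℝ) * (n - 1) * q ^ (m + 1 + m) ≤ (n : ℝ) * n * q ^ (m + 1 + m) := by
      gcongr
      linarith
    have h₂ : (n : ℝ) * n * q ^ (m + 1 + m) / (n * q ^ (m + 1)) ^ 2 = 1 / q := by
      field_simp
      ring
    calc _ ≤ (n : ℝ) * n * q ^ (m + 1 + m) / (n * q ^ (m + 1)) ^ 2 - 1 := by gcongr
      _ = (1 - q) / q := by
        rw [h₂]
        field_simp

end Fintype

lemma exp_le_mul_one_sub_pow {n : ℕ} (hn : 0 < n) {p a : ℝ} (hp₀ : 0 ≤ p) (hp : p ≤ 1 / 2)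
    (ha : 0 ≤ a) (hpn : p ≤ (log n - a) / n) :
    exp (a - 2 * (log n ^ 2 / n)) ≤ n * (1 - p) ^ (n - 1) := by
  have hn' : (0 : ℝ) < n := by exact_mod_cast hn
  have hlog : 0 ≤ log n := log_natCast_nonneg n
  -- Follows from 1/(1 - p) ≤ 1 + p + 2p², valid for 0 ≤ p ≤ 1/2.
  have h₁ : exp (-(p + 2 * p ^ 2)) ≤ 1 - p := by
    rw [exp_neg, inv_le_comm₀ (exp_pos _) (by linarith)]
    refine le_trans ?_ (add_one_le_exp _)
    rw [inv_le_iff_one_le_mul₀ (by linarith)]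
    nlinarith [mul_nonneg hp₀ hp₀, mul_nonneg (mul_nonneg hp₀ hp₀) (sub_nonneg.2 hp)]
  have h₂ : n * p ≤ log n - a := by
    rw [le_div_iff₀ hn'] at hpn
    linarith
  have h₃ : n * p ^ 2 ≤ log n ^ 2 / n := by
    rw [le_div_iff₀ hn']
    calc n * p ^ 2 * n = (n * p) ^ 2 := by ring
      _ ≤ log n ^ 2 := by
        gcongr
        linarith
  calc exp (a - 2 * (log n ^ 2 / n)) ≤ exp (log n + n * -(p + 2 * p ^ 2)) := by
        gcongr
        linarith
    _ = n * exp (-(p + 2 * p ^ 2)) ^ n := by rw [exp_add, exp_log hn', exp_nat_mul]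
    _ ≤ n * (1 - p) ^ n := by gcongr
    _ ≤ n * (1 - p) ^ (n - 1) := by
        gcongr ?_ * ?_
        exact pow_le_pow_of_le_one (by linarith) (by linarith) (Nat.sub_le _ _)

lemma tendsto_log_div_natCast : Tendsto (fun n : ℕ => log n / n) atTop (𝓝 0) := by
  have h := (tendsto_pow_log_div_mul_add_atTop 1 0 1 one_ne_zero).comp
    (tendsto_natCast_atTop_atTop (R := ℝ))
  simpa [Function.comp_def] using h

lemma tendsto_log_sq_div_natCast : Tendsto (fun n : ℕ => log n ^ 2 / n) atTop (𝓝 0) := by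
  have h := (tendsto_pow_log_div_mul_add_atTop 1 0 2 one_ne_zero).comp
    (tendsto_natCast_atTop_atTop (R := ℝ))
  simpa [Function.comp_def] using h

theorem tendsto_binomialRandom_real_no_isolated {p : ℕ → I} {α : ℕ → ℝ}
    (hα : Tendsto α atTop atTop) (hp : ∀ᶠ n : ℕ in atTop, (p n : ℝ) ≤ (log n - α n) / n) :
    Tendsto (fun n : ℕ => (binomialRandom (Fin n) (p n)).real {G | ∀ v, ∃ w, G.Adj v w})
      atTop (𝓝 0) := by
  have h₁ : Tendsto (fun n : ℕ => α n - 2 * (log n ^ 2 / n)) atTop atTop := by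
    have h := (tendsto_log_sq_div_natCast.const_mul 2).neg
    exact hα.atTop_add h
  have h₂ : Tendsto (fun n : ℕ => (exp (α n - 2 * (log n ^ 2 / n)))⁻¹ + 2 * (log n / n))
      atTop (𝓝 0) := by
    simpa using (tendsto_exp_atTop.comp h₁).inv_tendsto_atTop.add
      (tendsto_log_div_natCast.const_mul 2)
  refine tendsto_of_tendsto_of_tendsto_of_le_of_le' tendsto_const_nhds h₂
    (Eventually.of_forall fun _ => measureReal_nonneg) ?_
  filter_upwards [hp, hα.eventually_ge_atTop 0, eventually_ge_atTop 2,
    tendsto_log_div_natCast.eventually_le_const (by norm_num : (0 : ℝ) < 1 / 2)]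
    with n hpn hαn hn hlog
  have hpl : (p n : ℝ) ≤ log n / n := hpn.trans (by gcongr; linarith)
  have hp₀ : (0 : ℝ) ≤ p n := (p n).2.1
  have hp₂ : (p n : ℝ) ≤ 1 / 2 := hpl.trans hlog
  refine (binomialRandom_real_no_isolated_le (by linarith) (by simpa)).trans ?_
  rw [Fintype.card_fin]
  refine add_le_add ?_ ?_
  · gcongr
    exact exp_le_mul_one_sub_pow (by omega) hp₀ hp₂ hαn hpn
  · rw [div_le_iff₀ (by linarith)]
    nlinarith

end SimpleGraph

end

/-! ### Passage to the limit -/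

namespace SimpleGraph

open MeasureTheory unitInterval

variable {p : ℕ → I} {α : ℕ → ℝ}

lemma tendsto_measure_of_tendsto_real {Ω : ℕ → Type*} [∀ n, MeasurableSpace (Ω n)]
    {μ : ∀ n, Measure (Ω n)} [∀ n, IsFiniteMeasure (μ n)] {S : ∀ n, Set (Ω n)} {c : ℝ}
    (h : Tendsto (fun n => (μ n).real (S n)) atTop (𝓝 c)) :
    Tendsto (fun n => μ n (S n)) atTop (𝓝 (ENNReal.ofReal c)) := by
  simpa using ENNReal.tendsto_ofReal h

lemma tendsto_real_one_of_compl_le {Ω : ℕ → Type*} [∀ n, MeasurableSpace (Ω n)]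
    {μ : ∀ n, Measure (Ω n)} [∀ n, IsProbabilityMeasure (μ n)] {S : ∀ n, Set (Ω n)} {f : ℕ → ℝ}
    (hS : ∀ n, MeasurableSet (S n)) (hf : Tendsto f atTop (𝓝 0))
    (h : ∀ᶠ n in atTop, (μ n).real (S n)ᶜ ≤ f n) :
    Tendsto (fun n => μ n (S n)) atTop (𝓝 1) := by
  have h₁ : Tendsto (fun n => (μ n).real (S n)ᶜ) atTop (𝓝 0) :=
    tendsto_of_tendsto_of_tendsto_of_le_of_le' tendsto_const_nhds hf
      (Eventually.of_forall fun _ => measureReal_nonneg) h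
  have h₂ : Tendsto (fun n => (μ n).real (S n)) atTop (𝓝 1) := by
    have h₃ := h₁.const_sub 1
    rw [sub_zero] at h₃
    refine h₃.congr fun n => ?_
    rw [probReal_compl_eq_one_sub (hS n)]
    ring
  simpa using tendsto_measure_of_tendsto_real h₂

theorem tendsto_binomialRandom_real_not_connected (hα : Tendsto α atTop atTop)
    (hp : ∀ᶠ n : ℕ in atTop, (Real.log n + α n) / n ≤ (p n : ℝ)) :
    Tendsto (fun n : ℕ => (binomialRandom (Fin n) (p n)).real {G | ¬ G.Connected})
      atTop (𝓝 0) := by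
  have h : Tendsto (fun n => Real.exp (-(α n / 2)) * ∑' k, cutWeight k) atTop (𝓝 0) := by
    have := (Real.tendsto_exp_neg_atTop_nhds_zero.comp
      (hα.atTop_div_const two_pos)).mul_const (∑' k, cutWeight k)
    simpa using this
  refine tendsto_of_tendsto_of_tendsto_of_le_of_le' tendsto_const_nhds h
    (Eventually.of_forall fun _ => measureReal_nonneg) ?_
  filter_upwards [hp, hα.eventually_ge_atTop 0, eventually_ge_atTop 4] with n hpn hαn hn
  exact binomialRandom_real_not_connected_le_exp hαn hpn hn

theorem tendsto_binomialRandom_real_not_cfc_le_two (hα : Tendsto α atTop atTop)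
    (hp : ∀ᶠ n : ℕ in atTop, (Real.log n + α n) / n ≤ (p n : ℝ)) :
    Tendsto (fun n : ℕ => (binomialRandom (Fin n) (p n)).real
      {G | ¬ G.conflictFreeConnectionNumber ≤ 2}) atTop (𝓝 0) := by
  have h : Tendsto (fun n : ℕ => (binomialRandom (Fin n) (p n)).real {G | ¬ G.Connected} +
      Real.log n ^ 2 / n * ∑' k, 16 ^ k * cutWeight k) atTop (𝓝 0) := by
    simpa using (tendsto_binomialRandom_real_not_connected hα hp).add
      (tendsto_log_sq_div_natCast.mul_const (∑' k, 16 ^ k * cutWeight k))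
  refine tendsto_of_tendsto_of_tendsto_of_le_of_le' tendsto_const_nhds h
    (Eventually.of_forall fun _ => measureReal_nonneg) ?_
  filter_upwards [hp, hα.eventually_ge_atTop 0, eventually_ge_atTop 5,
    (Real.tendsto_log_atTop.comp (tendsto_natCast_atTop_atTop (R := ℝ))).eventually_ge_atTop 4]
    with n hpn hαn hn hlog
  have hpl : Real.log n / n ≤ (p n : ℝ) := le_trans (by gcongr; linarith) hpn
  refine le_trans ?_ (add_le_add_right (binomialRandom_real_connected_lt_le_log hpl hlog hn) _)
  refine le_trans (measureReal_mono ?_ (measure_ne_top _ _)) (measureReal_union_le _ _)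
  intro G hG
  by_cases hc : G.Connected
  · exact Or.inr ⟨hc, hG⟩
  · exact Or.inl hc

lemma not_conflictFreeConnectionNumber_eq_two_subset (n : ℕ) :
    {G : SimpleGraph (Fin n) | G.conflictFreeConnectionNumber = 2}ᶜ ⊆
      {G | ¬ G.conflictFreeConnectionNumber ≤ 2} ∪ {⊤} := by
  intro G hG
  by_cases h : G.conflictFreeConnectionNumber ≤ 2
  · exact Or.inr (eq_top_of_conflictFreeConnectionNumber_lt_two (lt_of_le_of_ne h hG))
  · exact Or.inl h

lemma binomialRandom_real_top (n : ℕ) (p : I) :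
    (binomialRandom (Fin n) p).real {⊤} = (p : ℝ) ^ n.choose 2 := by
  have h : (⊤ : SimpleGraph (Fin n)).edgeSet.ncard = n.choose 2 := by
    rw [← coe_edgeFinset, Set.ncard_coe_finset, card_edgeFinset_top_eq_card_choose_two,
      Fintype.card_fin]
  rw [measureReal_def, binomialRandom_singleton, h]
  simp

lemma forall_exists_adj_of_preconnected {n : ℕ} (hn : 2 ≤ n) {G : SimpleGraph (Fin n)}
    (hG : G.Preconnected) (v : Fin n) : ∃ w, G.Adj v w :=
  have : Nontrivial (Fin n) := Fin.nontrivial_iff_two_le.2 hn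
  hG.exists_adj_of_nontrivial v

/-- Serves both claims below the threshold: cfc ≤ 2 and connectivity each imply preconnectedness,
which for n ≥ 2 excludes isolated vertices. -/
theorem tendsto_binomialRandom_of_subset_preconnected (hα : Tendsto α atTop atTop)
    (hp : ∀ᶠ n : ℕ in atTop, (p n : ℝ) ≤ (Real.log n - α n) / n)
    (S : ∀ n, Set (SimpleGraph (Fin n))) (hS : ∀ n, ∀ G ∈ S n, G.Preconnected) :
    Tendsto (fun n : ℕ => binomialRandom (Fin n) (p n) (S n)) atTop (𝓝 0) := by
  have h : Tendsto (fun n : ℕ => (binomialRandom (Fin n) (p n)).real (S n)) atTop (𝓝 0) := by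
    refine tendsto_of_tendsto_of_tendsto_of_le_of_le' tendsto_const_nhds
      (tendsto_binomialRandom_real_no_isolated hα hp)
      (Eventually.of_forall fun _ => measureReal_nonneg) ?_
    filter_upwards [eventually_ge_atTop 2] with n hn
    exact measureReal_mono (fun G hG => forall_exists_adj_of_preconnected hn (hS n G hG))
      (measure_ne_top _ _)
  simpa using tendsto_measure_of_tendsto_real h

end SimpleGraph

theorem theorem1p8 (p : ℕ → unitInterval) (α : ℕ → ℝ) (hα : Tendsto α atTop atTop) :
    ((∀ᶠ n : ℕ in atTop, (Real.log n + α n) / n ≤ (p n : ℝ)) →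
      Tendsto (fun n : ℕ => SimpleGraph.binomialRandom (Fin n) (p n)
          {G | G.conflictFreeConnectionNumber ≤ 2}) atTop (𝓝 1) ∧
      Tendsto (fun n : ℕ => SimpleGraph.binomialRandom (Fin n) (p n)
          {G | G.Connected}) atTop (𝓝 1) ∧
      (Tendsto (fun n : ℕ => (p n : ℝ) ^ n.choose 2) atTop (𝓝 0) →
        Tendsto (fun n : ℕ => SimpleGraph.binomialRandom (Fin n) (p n)
          {G | G.conflictFreeConnectionNumber = 2}) atTop (𝓝 1))) ∧
    ((∀ᶠ n : ℕ in atTop, (p n : ℝ) ≤ (Real.log n - α n) / n) →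
      Tendsto (fun n : ℕ => SimpleGraph.binomialRandom (Fin n) (p n)
          {G | G.conflictFreeConnectionNumber ≤ 2}) atTop (𝓝 0) ∧
      Tendsto (fun n : ℕ => SimpleGraph.binomialRandom (Fin n) (p n)
          {G | G.Connected}) atTop (𝓝 0)) := by
  refine ⟨fun hp => ⟨?_, ?_, fun htop => ?_⟩, fun hp => ⟨?_, ?_⟩⟩
  · exact SimpleGraph.tendsto_real_one_of_compl_le (fun _ => (Set.toFinite _).measurableSet)
      (SimpleGraph.tendsto_binomialRandom_real_not_cfc_le_two hα hp)
      (Eventually.of_forall fun _ => le_rfl)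
  · exact SimpleGraph.tendsto_real_one_of_compl_le (fun _ => (Set.toFinite _).measurableSet)
      (SimpleGraph.tendsto_binomialRandom_real_not_connected hα hp)
      (Eventually.of_forall fun _ => le_rfl)
  · have h := (SimpleGraph.tendsto_binomialRandom_real_not_cfc_le_two hα hp).add htop
    rw [add_zero] at h
    refine SimpleGraph.tendsto_real_one_of_compl_le (fun _ => (Set.toFinite _).measurableSet) h
      (Eventually.of_forall fun n => ?_)
    rw [← SimpleGraph.binomialRandom_real_top]
    exact (MeasureTheory.measureReal_mono
      (SimpleGraph.not_conflictFreeConnectionNumber_eq_two_subset n)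
      (MeasureTheory.measure_ne_top _ _)).trans (MeasureTheory.measureReal_union_le _ _)
  · exact SimpleGraph.tendsto_binomialRandom_of_subset_preconnected hα hp _
      fun n G hG => SimpleGraph.preconnected_of_conflictFreeConnectionNumber_le_two hG
  · exact SimpleGraph.tendsto_binomialRandom_of_subset_preconnected hα hp _
      fun n G hG => SimpleGraph.Connected.preconnected hG
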